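/- All topological groups are assumed to be Hausdorff, and classes of topological groups are assumed to be closed under isomorphism of topological groups. Let $\mathcal G$ be a class of topological groups that is closed under formation of topological subgroups (subgroups with the subspace topology), and suppose that every topological group is isomorphic, as a topological group, with a topological subgroup of the direct product $\prod_{\alpha\in A} G_\alpha$ (with the product topology) of a family $(G_\alpha)_{\alpha\in A}$ of groups from $\mathcal G$. Then $\mathcal G$ is the class of all topological groups. -/

import Mathlib

universe u

/-- A Hausdorff topological group. -/
structure HausdorffTopGroup : Type (u + 1) where
  carrier : Type u
  [group : Group carrier]
  [topology : TopologicalSpace carrier]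
  [isTopologicalGroup : IsTopologicalGroup carrier]
  [t2 : T2Space carrier]

namespace HausdorffTopGroup

instance : CoeSort HausdorffTopGroup.{u} (Type u) := ⟨carrier⟩

attribute [instance] group topology isTopologicalGroup t2

/-- The direct product of a family of Hausdorff topological groups, with coordinatewise
operations and the product topology. -/
def prod {ι : Type u} (K : ι → HausdorffTopGroup.{u}) : HausdorffTopGroup.{u} where
  carrier := ∀ i, K i

/-- `G` is isomorphic, as a topological group, with a topological subgroup of `H`
(a subgroup with the subspace topology). -/
def IsIsoToSubgroupOf (G H : HausdorffTopGroup.{u}) : Prop :=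
  ∃ S : Subgroup H, Nonempty (G ≃ₜ* S)

/-- The class `𝒢` is closed under formation of topological subgroups. Subgroups are understood
up to isomorphism of topological groups, so that in particular `𝒢` is closed under isomorphism. -/
def ClosedUnderSubgroups (𝒢 : Set HausdorffTopGroup.{u}) : Prop :=
  ∀ G H : HausdorffTopGroup.{u}, H ∈ 𝒢 → G.IsIsoToSubgroupOf H → G ∈ 𝒢

end HausdorffTopGroup

/-! It suffices to embed a given group `H` in a group `K` with an element `t ≠ 1` such that every
continuous homomorphism on `K` not killing `t` embeds `H`: when `K` sits in a product, some
coordinate does not kill `t`, so `H` already embeds in that factor.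

For this, elements of `H` far from the identity should have conjugates `y`, by a common element,
with `y⁻¹ * t * y` near `1`. If such an `x` had image near `1`, so would `y`, and the image of `t`
would be arbitrarily near `1` (`isEmbedding_comp_of_conj_small`).

To get `K`, let `H` act by translation on a normed space `E` of bounded functions, and let `G = E ⋊
H` act on `E` by affine isometries. Scaling vectors makes displacements arbitrarily large. Then `K =
V ⋊ G`, where `V` consists of functions on `E` under uniform convergence on bounded sets, and `t` is
a bump: pushed far away, it tends to `0`. -/

open Filter Topology Uniformity Bornology UniformConvergence

/-! ### Topological semidirect products -/

/-- The semidirect product of an additive group `V` with a group `G` acting on it. -/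
@[ext]
structure AddSemidirect (V G : Type*) where
  /-- the component in the normal factor -/
  left : V
  /-- the component in the acting group -/
  right : G

namespace AddSemidirect

variable {V G : Type*}

section Topology

variable [TopologicalSpace V] [TopologicalSpace G]

instance : TopologicalSpace (AddSemidirect V G) :=
  TopologicalSpace.induced (fun a => (a.left, a.right)) inferInstance

theorem isEmbedding_prod :
    IsEmbedding (fun a : AddSemidirect V G => (a.left, a.right)) :=
  ⟨⟨rfl⟩, fun a b h => by
    simp only [Prod.mk.injEq] at h
    exact AddSemidirect.ext h.1 h.2⟩

theorem continuous_left : Continuous (left : AddSemidirect V G → V) :=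
  continuous_fst.comp isEmbedding_prod.continuous

theorem continuous_right : Continuous (right : AddSemidirect V G → G) :=
  continuous_snd.comp isEmbedding_prod.continuous

instance [T2Space V] [T2Space G] : T2Space (AddSemidirect V G) := isEmbedding_prod.t2Space

end Topology

instance [AddGroup V] [Group G] : One (AddSemidirect V G) := ⟨⟨0, 1⟩⟩

@[simp] theorem one_left [AddGroup V] [Group G] : (1 : AddSemidirect V G).left = 0 := rfl

@[simp] theorem one_right [AddGroup V] [Group G] : (1 : AddSemidirect V G).right = 1 := rfl

variable [AddGroup V] [Group G] [DistribMulAction G V]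

instance : Mul (AddSemidirect V G) := ⟨fun a b => ⟨a.left + a.right • b.left, a.right * b.right⟩⟩

instance : Inv (AddSemidirect V G) := ⟨fun a => ⟨-(a.right⁻¹ • a.left), a.right⁻¹⟩⟩

@[simp] theorem mul_left (a b : AddSemidirect V G) :
    (a * b).left = a.left + a.right • b.left := rfl

@[simp] theorem mul_right (a b : AddSemidirect V G) : (a * b).right = a.right * b.right := rfl

@[simp] theorem inv_left (a : AddSemidirect V G) : a⁻¹.left = -(a.right⁻¹ • a.left) := rfl

@[simp] theorem inv_right (a : AddSemidirect V G) : a⁻¹.right = a.right⁻¹ := rfl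

instance : Group (AddSemidirect V G) :=
  Group.ofLeftAxioms
    (fun a b c => by ext <;> simp [mul_smul, add_assoc, mul_assoc])
    (fun a => by ext <;> simp)
    (fun a => by ext <;> simp)

/-- The inclusion of the acting group. -/
def inr : G →* AddSemidirect V G where
  toFun g := ⟨0, g⟩
  map_one' := rfl
  map_mul' a b := by ext <;> simp

@[simp] theorem inr_left (g : G) : (inr g : AddSemidirect V G).left = 0 := rfl

@[simp] theorem inr_right (g : G) : (inr g : AddSemidirect V G).right = g := rfl

theorem inr_conj (v : V) (g : G) :
    (inr g : AddSemidirect V G)⁻¹ * ⟨v, 1⟩ * inr g = ⟨g⁻¹ • v, 1⟩ := by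
  ext <;> simp

section Topology

variable [TopologicalSpace V] [TopologicalSpace G]

instance [IsTopologicalAddGroup V] [IsTopologicalGroup G] [ContinuousSMul G V] :
    IsTopologicalGroup (AddSemidirect V G) where
  continuous_mul := by
    refine isEmbedding_prod.continuous_iff.2 (Continuous.prodMk ?_ ?_)
    · exact (continuous_left.comp continuous_fst).add
        ((continuous_right.comp continuous_fst).smul (continuous_left.comp continuous_snd))
    · exact (continuous_right.comp continuous_fst).mul (continuous_right.comp continuous_snd)
  continuous_inv := by
    refine isEmbedding_prod.continuous_iff.2 (Continuous.prodMk ?_ ?_)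
    · exact (continuous_right.inv.smul continuous_left).neg
    · exact continuous_right.inv

theorem isEmbedding_inr : IsEmbedding (inr : G → AddSemidirect V G) :=
  IsEmbedding.of_comp (isEmbedding_prod.continuous_iff.2 (by
    exact Continuous.prodMk continuous_const continuous_id)) continuous_right IsEmbedding.id

end Topology

end AddSemidirect

/-! ### The conjugation criterion -/

/-- If every `x` outside a given neighbourhood of the identity of `H` has a conjugate `y`, by an
element not depending on `x`, such that `y⁻¹ * t * y` is close to the identity, then a homomorphism
not killing `t` restricts to an embedding of `H`. -/
theorem isEmbedding_comp_of_conj_small {H K L : Type*} [Group H] [TopologicalSpace H]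
    [IsTopologicalGroup H] [T2Space H] [Group K] [TopologicalSpace K] [IsTopologicalGroup K]
    [Group L] [TopologicalSpace L] [IsTopologicalGroup L] [T2Space L]
    (j : H →* K) (hj : Continuous j) (t : K)
    (ht : ∀ U ∈ 𝓝 (1 : H), ∀ O ∈ 𝓝 (1 : K), ∃ g : K, ∀ x ∉ U,
      (g * j x * g⁻¹)⁻¹ * t * (g * j x * g⁻¹) ∈ O)
    (f : K →* L) (hf : Continuous f) (hft : f t ≠ 1) :
    IsEmbedding (f.comp j) := by
  have hc : Continuous (f.comp j) := hf.comp hj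
  have key : ∀ U ∈ 𝓝 (1 : H), ∃ N ∈ 𝓝 (1 : L), ∀ x, f (j x) ∈ N → x ∈ U := by
    intro U hU
    have hlim : Tendsto (fun p : L × L => p.1 * p.2 * p.1⁻¹) (𝓝 (1, 1)) (𝓝 1) := by
      have : Continuous (fun p : L × L => p.1 * p.2 * p.1⁻¹) := by fun_prop
      simpa using this.tendsto (1, 1)
    have h1 := hlim (isOpen_compl_singleton.mem_nhds (Ne.symm hft) : {f t}ᶜ ∈ 𝓝 (1 : L))
    rw [nhds_prod_eq, mem_map] at h1
    obtain ⟨A, hA, B, hB, hAB⟩ := mem_prod_iff.1 h1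
    obtain ⟨g, hg⟩ := ht U hU (f ⁻¹' B) (hf.continuousAt (by simpa using hB))
    -- The neighbourhood may depend on `g`, since one `g` serves all `x ∉ U`.
    have hconj : Continuous (fun l : L => f g * l * (f g)⁻¹) := by fun_prop
    refine ⟨_, hconj.continuousAt (x := 1) (by simpa using hA), fun x hx => ?_⟩
    by_contra hxU
    have h2 := @hAB (f g * f (j x) * (f g)⁻¹, _) ⟨hx, hg x hxU⟩
    apply h2
    simp only [map_mul, map_inv, Set.mem_singleton_iff]
    group
  refine ⟨?_, ?_⟩
  · refine ⟨IsTopologicalGroup.ext inferInstance (topologicalGroup_induced (f.comp j)) ?_⟩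
    rw [nhds_induced]
    refine le_antisymm (hc.continuousAt.le_comap) fun U hU => ?_
    obtain ⟨N, hN, hNU⟩ := key U hU
    exact ⟨N, by simpa using hN, hNU⟩
  · refine (injective_iff_map_eq_one _).2 fun x hx => ?_
    by_contra hne
    obtain ⟨N, hN, hNU⟩ := key {x}ᶜ (isOpen_compl_singleton.mem_nhds (Ne.symm hne))
    exact hNU x (by rw [show f (j x) = 1 from hx]; exact mem_of_mem_nhds hN) rfl

/-! ### Functions under uniform convergence on bounded sets -/

/-- The real functions on a space `Z`, uniformly on bounded sets. -/
abbrev BddConvFun (Z : Type*) [Bornology Z] := Z →ᵤ[{S : Set Z | IsBounded S}] ℝ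

/-- The real functions on `Z` whose translates under `G` depend continuously on the translating
element, for the topology of uniform convergence on bounded sets. -/
def ContTranslates (G Z : Type*) [Group G] [TopologicalSpace G] [IsTopologicalGroup G]
    [Bornology Z] [MulAction G Z] : AddSubgroup (BddConvFun Z) where
  carrier := {v | Continuous fun g : G =>
    (UniformOnFun.ofFun _ fun z => UniformOnFun.toFun _ v (g⁻¹ • z) : BddConvFun Z)}
  zero_mem' := (continuous_const : Continuous fun _ : G => (0 : BddConvFun Z))
  add_mem' ha hb := Continuous.add ha hb
  neg_mem' ha := Continuous.neg ha

namespace ContTranslates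

variable {G Z : Type*} [Group G] [TopologicalSpace G] [IsTopologicalGroup G]

section Action

variable [Bornology Z] [MulAction G Z]

/-- The underlying function of an element of `ContTranslates G Z`. -/
def eval (v : ContTranslates G Z) : Z → ℝ := UniformOnFun.toFun _ v.1

theorem eval_injective : Function.Injective (eval : ContTranslates G Z → Z → ℝ) :=
  fun _ _ h => Subtype.ext (UniformOnFun.toFun _ |>.injective h)

instance : SMul G (ContTranslates G Z) where
  smul g v := ⟨UniformOnFun.ofFun _ fun z => eval v (g⁻¹ • z), by
    have := (v.2 : Continuous _).comp (continuous_mul_const g)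
    refine this.congr fun k => ?_
    simp only [Function.comp_apply, mul_inv_rev, mul_smul]
    rfl⟩

@[simp] theorem eval_smul (g : G) (v : ContTranslates G Z) (z : Z) :
    eval (g • v) z = eval v (g⁻¹ • z) := rfl

@[simp] theorem eval_add (v w : ContTranslates G Z) (z : Z) :
    eval (v + w) z = eval v z + eval w z := rfl

@[simp] theorem eval_zero (z : Z) : eval (0 : ContTranslates G Z) z = 0 := rfl

instance : DistribMulAction G (ContTranslates G Z) where
  one_smul v := eval_injective (by ext z; simp)
  mul_smul g h v := eval_injective (by ext z; simp [mul_smul])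
  smul_zero g := eval_injective (by ext z; simp)
  smul_add g v w := eval_injective (by ext z; simp)

instance : T2Space (ContTranslates G Z) := by
  have : T2Space (BddConvFun Z) := UniformOnFun.t2Space_of_covering
    (Set.eq_univ_of_forall fun z => ⟨{z}, isBounded_singleton, rfl⟩)
  infer_instance

theorem tendsto_iff {ι : Type*} {l : Filter ι} {F : ι → ContTranslates G Z}
    {v : ContTranslates G Z} :
    Tendsto F l (𝓝 v) ↔ ∀ S : Set Z, IsBounded S → ∀ ε > 0, ∀ᶠ i in l, ∀ z ∈ S,
      |eval v z - eval (F i) z| < ε := by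
  rw [tendsto_subtype_rng, UniformOnFun.tendsto_iff_tendstoUniformlyOn]
  simp only [Metric.tendstoUniformlyOn_iff, Real.dist_eq]
  rfl

end Action

variable [PseudoMetricSpace Z] [MulAction G Z] [ContinuousSMul G Z] [IsIsometricSMul G Z]

/-- For `g` near `g₀`, isometry keeps all the sets `g⁻¹ • S` in one ball, on which nearby functions
are uniformly close. -/
instance : ContinuousSMul G (ContTranslates G Z) where
  continuous_smul := by
    rw [continuous_iff_continuousAt]
    rintro ⟨g₀, v₀⟩
    refine tendsto_iff.2 fun S hS ε hε => ?_
    obtain _ | hZ := isEmpty_or_nonempty Z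
    · exact Eventually.of_forall fun _ z => isEmptyElim z
    obtain ⟨z₀⟩ := hZ
    obtain ⟨R, hR⟩ := hS.subset_closedBall z₀
    have h1 : Tendsto (fun p : G × ContTranslates G Z => p.1 • v₀) (𝓝 (g₀, v₀)) (𝓝 (g₀ • v₀)) := by
      have : Continuous fun g : G => g • v₀ := continuous_induced_rng.2 v₀.2
      exact (this.comp continuous_fst).tendsto (g₀, v₀)
    have h2 := tendsto_iff.1 (continuous_snd.tendsto (g₀, v₀))
      (Metric.closedBall z₀ (R + dist (g₀ • z₀) z₀ + 1)) Metric.isBounded_closedBall (ε / 2)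
      (by positivity)
    have h3 : ∀ᶠ p in 𝓝 (g₀, v₀), dist (p.1 • z₀) (g₀ • z₀) < 1 := by
      have : Continuous fun p : G × ContTranslates G Z => p.1 • z₀ :=
        continuous_fst.smul continuous_const
      exact (Metric.tendsto_nhds.1 (this.tendsto (g₀, v₀))) 1 one_pos
    filter_upwards [tendsto_iff.1 h1 S hS (ε / 2) (by positivity), h2, h3] with p hp1 hp2 hp3 z hz
    have hz' := Metric.mem_closedBall.1 (hR hz)
    have hmem : p.1⁻¹ • z ∈ Metric.closedBall z₀ (R + dist (g₀ • z₀) z₀ + 1) := by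
      rw [Metric.mem_closedBall, ← dist_smul p.1, smul_inv_smul]
      have e1 := dist_triangle z z₀ (p.1 • z₀)
      have e2 := dist_triangle z₀ (g₀ • z₀) (p.1 • z₀)
      rw [dist_comm z₀ (g₀ • z₀), dist_comm (g₀ • z₀) (p.1 • z₀)] at e2
      linarith
    have a1 := hp1 z hz
    have a2 := hp2 _ hmem
    simp only [eval_smul] at a1 a2 ⊢
    have := abs_sub_le (eval v₀ (g₀⁻¹ • z)) (eval v₀ (p.1⁻¹ • z)) (eval p.2 (p.1⁻¹ • z))
    linarith

variable (G) in
/-- A bump function around the point `z₀`. -/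
def bump (z₀ : Z) : ContTranslates G Z :=
  ⟨UniformOnFun.ofFun _ fun z => max 0 (1 - dist z z₀), by
    change Continuous _
    rw [continuous_iff_continuousAt]
    intro g₀
    refine UniformOnFun.tendsto_iff_tendstoUniformlyOn.2 fun S _ => ?_
    refine Metric.tendstoUniformlyOn_iff.2 fun ε hε => ?_
    have : Continuous fun g : G => g • z₀ := continuous_id.smul continuous_const
    filter_upwards [Metric.tendsto_nhds.1 (this.tendsto g₀) ε hε] with g hg z _
    refine lt_of_le_of_lt ?_ hg
    have e : ∀ k : G, dist (k⁻¹ • z) z₀ = dist z (k • z₀) := fun k => by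
      rw [← dist_smul k, smul_inv_smul]
    change |max 0 (1 - dist (g₀⁻¹ • z) z₀) - max 0 (1 - dist (g⁻¹ • z) z₀)| ≤ _
    rw [e, e]
    rw [max_comm 0, max_comm 0]
    refine (abs_max_sub_max_le_abs _ _ _).trans ?_
    rw [sub_sub_sub_cancel_left, dist_comm z, dist_comm z]
    exact abs_dist_sub_le _ _ _⟩

@[simp] theorem eval_bump (z₀ z : Z) : eval (bump G z₀) z = max 0 (1 - dist z z₀) := rfl

end ContTranslates

/-- A group acting isometrically on a metric space, so that elements away from the identity move
some translate of a base point far away, embeds in a topological group as required by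
`isEmbedding_comp_of_conj_small`. -/
theorem exists_conj_small_of_isometric {H G Z : Type*} [Group H] [TopologicalSpace H] [Group G]
    [TopologicalSpace G] [IsTopologicalGroup G] [PseudoMetricSpace Z] [MulAction G Z]
    [ContinuousSMul G Z] [IsIsometricSMul G Z] (i : H →* G) (z₀ : Z)
    (hi : ∀ U ∈ 𝓝 (1 : H), ∀ R : ℝ, ∃ g : G, ∀ x ∉ U, R ≤ dist (i x • g • z₀) (g • z₀)) :
    ∃ t : AddSemidirect (ContTranslates G Z) G, t ≠ 1 ∧
      ∀ U ∈ 𝓝 (1 : H), ∀ O ∈ 𝓝 (1 : AddSemidirect (ContTranslates G Z) G),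
      ∃ g : AddSemidirect (ContTranslates G Z) G, ∀ x ∉ U,
      (g * AddSemidirect.inr (i x) * g⁻¹)⁻¹ * t * (g * AddSemidirect.inr (i x) * g⁻¹) ∈ O := by
  refine ⟨⟨ContTranslates.bump G z₀, 1⟩, fun h => ?_, fun U hU O hO => ?_⟩
  · have h1 : ContTranslates.bump G z₀ = 0 := congrArg AddSemidirect.left h
    have h2 := congrArg (fun v => ContTranslates.eval v z₀) h1
    simp at h2
  choose g hg using fun n : ℕ => hi U hU n
  let y : ℕ × (Uᶜ : Set H) → G := fun p => (g p.1)⁻¹ * i p.2 * g p.1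
  -- The factor `⊤` makes the convergence uniform over `x ∉ U`.
  have hF : Tendsto (fun p => (y p)⁻¹ • ContTranslates.bump G z₀) (atTop ×ˢ ⊤) (𝓝 0) := by
    refine ContTranslates.tendsto_iff.2 fun S hS ε hε => ?_
    obtain ⟨R, hR⟩ := hS.subset_closedBall z₀
    obtain ⟨n, hn⟩ := exists_nat_ge (R + 1)
    rw [eventually_prod_iff]
    refine ⟨_, eventually_ge_atTop n, fun _ => True, by simp, fun {m} hm {x} _ z hz => ?_⟩
    have hz' := Metric.mem_closedBall.1 (hR hz)
    have h1 := hg m x x.2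
    have hm' : (n : ℝ) ≤ m := by exact_mod_cast hm
    have h2 : dist (y (m, x) • z₀) z₀ = dist (i x • g m • z₀) (g m • z₀) := by
      rw [← dist_smul (g m)]
      simp [y, smul_smul, mul_assoc]
    -- For `z` within `R` of `z₀`, the point `y • z` is at distance at least `m - R ≥ 1` from `z₀`,
    -- off the bump.
    have h3 := dist_triangle_left (y (m, x) • z₀) z₀ (y (m, x) • z)
    have h4 : max 0 (1 - dist (y (m, x) • z) z₀) = 0 := by
      rw [dist_smul] at h3
      apply max_eq_left
      linarith
    simpa [h4] using hε
  have hF' : Tendsto (fun p => (⟨(y p)⁻¹ • ContTranslates.bump G z₀, 1⟩ :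
      AddSemidirect (ContTranslates G Z) G)) (atTop ×ˢ ⊤) (𝓝 1) :=
    AddSemidirect.isEmbedding_prod.tendsto_nhds_iff.2 (hF.prodMk_nhds tendsto_const_nhds)
  obtain ⟨P, hP, Q, hQ, hPQ⟩ := mem_prod_iff.1 (hF' hO)
  obtain ⟨n, hn⟩ := mem_atTop_sets.1 hP
  rw [mem_top] at hQ
  refine ⟨AddSemidirect.inr (g n)⁻¹, fun x hx => ?_⟩
  have hmem := @hPQ (n, ⟨x, hx⟩) ⟨hn n le_rfl, hQ ▸ Set.mem_univ _⟩
  rw [← map_inv, inv_inv, ← map_mul, ← map_mul, AddSemidirect.inr_conj]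
  exact hmem

/-! ### The affine isometric action -/

namespace AddSemidirect

variable {E H : Type*} [NormedAddCommGroup E] [Group H] [DistribMulAction H E]

/-- The affine action of the semidirect product `E ⋊ H` on `E`. -/
instance : MulAction (AddSemidirect E H) E where
  smul g e := g.left + g.right • e
  one_smul e := by change (0 : E) + (1 : H) • e = e; simp
  mul_smul a b e := by
    change (a.left + a.right • b.left) + (a.right * b.right) • e =
      a.left + a.right • (b.left + b.right • e)
    simp [mul_smul, add_assoc]

theorem smul_def (g : AddSemidirect E H) (e : E) : g • e = g.left + g.right • e := rfl

instance [IsIsometricSMul H E] : IsIsometricSMul (AddSemidirect E H) E :=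
  ⟨fun g => Isometry.of_dist_eq fun a b => by simp [smul_def]⟩

instance [TopologicalSpace H] [ContinuousSMul H E] : ContinuousSMul (AddSemidirect E H) E where
  continuous_smul :=
    (continuous_left.comp continuous_fst).add
      ((continuous_right.comp continuous_fst).smul continuous_snd)

end AddSemidirect

/-! ### Translation on bounded functions -/

section BoundedFunctions

variable {H : Type*} [Group H] [TopologicalSpace H] [IsTopologicalGroup H]

open BoundedContinuousFunction

/-- Left translation of a bounded continuous function. -/
def leftTranslate (h : H) (f : H →ᵇ ℝ) : H →ᵇ ℝ :=
  f.compContinuous ⟨fun z => h⁻¹ * z, continuous_const_mul _⟩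

@[simp] theorem leftTranslate_apply (h : H) (f : H →ᵇ ℝ) (z : H) :
    leftTranslate h f z = f (h⁻¹ * z) := rfl

theorem dist_leftTranslate (h : H) (a b : H →ᵇ ℝ) :
    dist (leftTranslate h a) (leftTranslate h b) = dist a b := by
  refine le_antisymm ((dist_le dist_nonneg).2 fun z => dist_coe_le_dist (h⁻¹ * z))
    ((dist_le dist_nonneg).2 fun z => ?_)
  simpa using dist_coe_le_dist (f := leftTranslate h a) (g := leftTranslate h b) (h * z)

variable (H) in
/-- The bounded functions on `H` whose left translates depend continuously on the translating
element. -/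
def BddUnifCont : Submodule ℝ (H →ᵇ ℝ) where
  carrier := {f | Continuous fun h : H => leftTranslate h f}
  zero_mem' := (continuous_const : Continuous fun _ : H => (0 : H →ᵇ ℝ))
  add_mem' ha hb := Continuous.add ha hb
  smul_mem' c _ ha := Continuous.const_smul (α := H →ᵇ ℝ) ha c

namespace BddUnifCont

instance : SMul H (BddUnifCont H) where
  smul h f := ⟨leftTranslate h f.1, by
    refine ((f.2 : Continuous _).comp (continuous_mul_const h)).congr fun k => ?_
    ext z
    simp [mul_assoc]⟩

theorem smul_val (h : H) (f : BddUnifCont H) : (h • f).1 = leftTranslate h f.1 := rfl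

instance : DistribMulAction H (BddUnifCont H) where
  one_smul f := Subtype.ext (by ext z; simp [smul_val])
  mul_smul g h f := Subtype.ext (by ext z; simp [smul_val, mul_assoc])
  smul_zero g := Subtype.ext (by ext z; simp [smul_val])
  smul_add g v w := Subtype.ext (by ext z; simp [smul_val])

instance : IsIsometricSMul H (BddUnifCont H) :=
  ⟨fun h => Isometry.of_dist_eq fun a b => dist_leftTranslate h a.1 b.1⟩

instance : ContinuousSMul H (BddUnifCont H) where
  continuous_smul := by
    refine continuous_iff_continuousAt.2 fun ⟨h₀, f₀⟩ => ?_
    have h1 : Tendsto (fun p : H × BddUnifCont H => p.1 • f₀) (𝓝 (h₀, f₀)) (𝓝 (h₀ • f₀)) := by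
      have : Continuous fun h : H => h • f₀ := continuous_induced_rng.2 f₀.2
      exact (this.comp continuous_fst).tendsto (h₀, f₀)
    refine Metric.tendsto_nhds.2 fun ε hε => ?_
    filter_upwards [Metric.tendsto_nhds.1 h1 (ε / 2) (by positivity),
      Metric.tendsto_nhds.1 (continuous_snd.tendsto (h₀, f₀)) (ε / 2) (by positivity)] with p h1 h2
    have := dist_triangle (p.1 • p.2) (p.1 • f₀) (h₀ • f₀)
    rw [dist_smul] at this
    change dist (p.1 • p.2) (h₀ • f₀) < ε
    linarith

end BddUnifCont

end BoundedFunctions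

/-! ### Pseudometrics and displacement -/

/-- Every entourage of a uniform space contains an entourage of a countably generated coarser
uniformity. -/
theorem exists_coarser_countablyGenerated {X : Type*} [u : UniformSpace X] {s : Set (X × X)}
    (hs : s ∈ 𝓤 X) : ∃ u' : UniformSpace X, u ≤ u' ∧ (𝓤[u']).IsCountablyGenerated ∧ s ∈ 𝓤[u'] := by
  have step : ∀ v : {v : Set (X × X) // v ∈ 𝓤 X}, ∃ w : {v : Set (X × X) // v ∈ 𝓤 X},
      (∀ a b, (a, b) ∈ w.1 → (b, a) ∈ w.1) ∧
      ∀ a b c, (a, b) ∈ w.1 → (b, c) ∈ w.1 → (a, c) ∈ v.1 := by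
    intro v
    obtain ⟨w, hw, hsymm, hcomp⟩ := comp_symm_mem_uniformity_sets v.2
    exact ⟨⟨w, hw⟩, fun a b h => hsymm.symm _ _ h, fun a b c h h' => hcomp ⟨b, h, h'⟩⟩
  choose next hsymm hcomp using step
  -- Iteration starts one step below `s`, which need not be symmetric.
  let w : ℕ → {v : Set (X × X) // v ∈ 𝓤 X} := fun n => next^[n + 1] ⟨s, hs⟩
  have hw : ∀ n, w (n + 1) = next (w n) := fun n => Function.iterate_succ_apply' _ _ _
  have hws : ∀ n a b, (a, b) ∈ (w n).1 → (b, a) ∈ (w n).1 := by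
    intro n
    simp only [w, Function.iterate_succ_apply']
    exact hsymm _
  have hwc : ∀ n a b c, (a, b) ∈ (w (n + 1)).1 → (b, c) ∈ (w (n + 1)).1 → (a, c) ∈ (w n).1 := by
    intro n
    rw [hw]
    exact hcomp _
  have hrefl : ∀ n a, (a, a) ∈ (w n).1 := fun n a => refl_mem_uniformity (w n).2
  have hanti : Antitone fun n => (w n).1 :=
    antitone_nat_of_succ_le fun n p hp => hwc n p.1 p.2 p.2 hp (hrefl _ _)
  let B : FilterBasis (X × X) :=
    { sets := Set.range fun n => (w n).1
      nonempty := Set.range_nonempty _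
      inter_sets := by
        rintro _ _ ⟨m, rfl⟩ ⟨n, rfl⟩
        exact ⟨_, ⟨max m n, rfl⟩, Set.subset_inter (hanti (le_max_left m n))
          (hanti (le_max_right m n))⟩ }
  let c : UniformSpace.Core X := UniformSpace.Core.mkOfBasis B
    (by rintro _ ⟨n, rfl⟩ a; exact hrefl n a)
    (by rintro _ ⟨n, rfl⟩; exact ⟨_, ⟨n, rfl⟩, fun p hp => hws n p.1 p.2 hp⟩)
    (by
      rintro _ ⟨n, rfl⟩
      exact ⟨_, ⟨n + 1, rfl⟩, fun p ⟨z, h, h'⟩ => hwc n p.1 z p.2 h h'⟩)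
  have hc : ∀ n, (w n).1 ∈ B.filter := fun n => B.mem_filter_of_mem ⟨n, rfl⟩
  have hle : u ≤ UniformSpace.ofCore c := by
    rw [UniformSpace.le_def]
    intro r hr
    obtain ⟨_, ⟨n, rfl⟩, hn⟩ := (FilterBasis.mem_filter_iff B).1 hr
    exact mem_of_superset (w n).2 hn
  refine ⟨UniformSpace.ofCore c, hle, ?_, ?_⟩
  · refine HasCountableBasis.isCountablyGenerated (p := fun _ : ℕ => True)
      (s := fun n => (w n).1) ⟨⟨fun r => ⟨fun hr => ?_, fun ⟨n, _, hn⟩ => ?_⟩⟩, Set.to_countable _⟩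
    · obtain ⟨_, ⟨n, rfl⟩, hn⟩ := (FilterBasis.mem_filter_iff B).1 hr
      exact ⟨n, trivial, hn⟩
    · exact mem_of_superset (hc n) hn
  · exact mem_of_superset (hc 0) fun p hp => hcomp ⟨s, hs⟩ p.1 p.2 p.2 hp (hrefl 0 _)

/-- Entourages of a uniform space are detected by uniformly continuous pseudometrics. -/
theorem exists_pseudometric_of_mem_uniformity {X : Type*} [UniformSpace X] {s : Set (X × X)}
    (hs : s ∈ 𝓤 X) : ∃ d : X → X → ℝ, (∀ a, d a a = 0) ∧ (∀ a b c, |d a c - d b c| ≤ d a b) ∧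
      (∀ ε > 0, {p : X × X | d p.1 p.2 < ε} ∈ 𝓤 X) ∧ ∀ a b, d a b < 1 → (a, b) ∈ s := by
  obtain ⟨u', hle, hcg, hs'⟩ := exists_coarser_countablyGenerated hs
  obtain ⟨D, rfl⟩ := @UniformSpace.metrizable_uniformity X u' hcg
  obtain ⟨δ, hδ, hδs⟩ := (@Metric.mem_uniformity_dist X D _).1 hs'
  refine ⟨fun a b => D.dist a b / δ, fun a => ?_, fun a b c => ?_, fun ε hε => ?_, fun a b h => ?_⟩
  · change D.dist a a / δ = 0
    rw [@dist_self X D, zero_div]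
  · rw [← sub_div, abs_div, abs_of_pos hδ]
    exact div_le_div_of_nonneg_right (@abs_dist_sub_le X D _ _ _) hδ.le
  · refine hle ((@Metric.mem_uniformity_dist X D _).2 ⟨ε * δ, by positivity, fun a b h => ?_⟩)
    exact (div_lt_iff₀ hδ).2 h
  · exact hδs ((div_lt_one hδ).1 h)

/-- Displacement of suitable bounded functions detects neighbourhoods of the identity. -/
theorem exists_norm_smul_sub_ge {H : Type*} [Group H] [TopologicalSpace H] [IsTopologicalGroup H]
    {U : Set H} (hU : U ∈ 𝓝 (1 : H)) : ∃ f : BddUnifCont H, ∀ x ∉ U, 1 ≤ ‖x • f - f‖ := by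
  -- In this uniformity `k * z` is close to `z` uniformly in `z` as `k → 1`, which left translation
  -- requires.
  let u : UniformSpace H := IsTopologicalGroup.rightUniformSpace H
  have hs : (fun p : H × H => p.2 * p.1⁻¹) ⁻¹' U⁻¹ ∈ 𝓤 H :=
    preimage_mem_comap (inv_mem_nhds_one H hU)
  obtain ⟨d, hd0, hdt, hdu, hds⟩ := exists_pseudometric_of_mem_uniformity hs
  have hnn : ∀ a b, 0 ≤ d a b := fun a b => (abs_nonneg _).trans (hdt a b a)
  let F : H → ℝ := fun z => min (d z 1) 1
  have hF : ∀ ε > 0, ∀ᶠ k in 𝓝 (1 : H), ∀ z, |F z - F (k * z)| < ε := by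
    intro ε hε
    obtain ⟨N, hN, hNd⟩ := mem_comap.1 (hdu ε hε)
    filter_upwards [hN] with k hk z
    have h1 : d z (k * z) < ε := @hNd (z, k * z) (by simpa using hk)
    refine ((abs_min_sub_min_le_max _ _ _ _).trans (max_le (hdt _ _ _) ?_)).trans_lt h1
    simpa using hnn _ _
  have hFc : Continuous F := by
    refine continuous_iff_continuousAt.2 fun z => Metric.tendsto_nhds.2 fun ε hε => ?_
    have h1 : Tendsto (fun w => w * z⁻¹) (𝓝 z) (𝓝 1) := by
      simpa using (continuous_mul_const z⁻¹).tendsto z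
    filter_upwards [h1.eventually (hF ε hε)] with w hw
    rw [dist_comm, Real.dist_eq]
    simpa using hw z
  have hF0 : ∀ z, 0 ≤ F z := fun z => le_min (hnn _ _) zero_le_one
  let f : BoundedContinuousFunction H ℝ := BoundedContinuousFunction.ofNormedAddCommGroup F hFc 1
    fun z => by rw [Real.norm_of_nonneg (hF0 z)]; exact min_le_right _ _
  refine ⟨⟨f, ?_⟩, fun x hx => ?_⟩
  · change Continuous fun h : H => leftTranslate h f
    refine continuous_iff_continuousAt.2 fun h₀ => Metric.tendsto_nhds.2 fun ε hε => ?_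
    have h1 : Tendsto (fun h : H => h⁻¹ * h₀) (𝓝 h₀) (𝓝 1) := by
      simpa using (continuous_inv.mul continuous_const).tendsto (f := fun h : H => h⁻¹ * h₀) h₀
    filter_upwards [h1.eventually (hF (ε / 2) (by positivity))] with h hh
    refine lt_of_le_of_lt ((BoundedContinuousFunction.dist_le (by positivity)).2 fun z => ?_)
      (half_lt_self hε)
    rw [dist_comm, Real.dist_eq]
    have h2 := (hh (h₀⁻¹ * z)).le
    rwa [mul_assoc, mul_inv_cancel_left] at h2
  · have h1 := BoundedContinuousFunction.norm_coe_le_norm (leftTranslate x f - f) x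
    -- At the point `x` the difference equals `f 1 - f x = 0 - 1`.
    refine le_trans ?_ h1
    have h2 : 1 ≤ d x 1 := by
      by_contra hlt
      have h3 : (1 : H) * x⁻¹ ∈ U⁻¹ := hds x 1 (not_le.1 hlt)
      exact hx (by simpa using h3)
    have h4 : f 1 = 0 := by
      change min (d 1 1) 1 = 0
      simp [hd0]
    have h5 : f x = 1 := min_eq_right h2
    simp [h4, h5]

/-! ### The overgroup and the conclusion -/

/-- Every topological group `H` embeds in a Hausdorff topological group `K` such that every
continuous homomorphism on `K` not killing a certain element restricts to an embedding of `H`,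
provided that `H` acts suitably on a normed space. -/
theorem exists_rigid_overgroup_of_normedSpace {H E : Type u} [Group H] [TopologicalSpace H]
    [IsTopologicalGroup H] [T2Space H] [NormedAddCommGroup E] [NormedSpace ℝ E]
    [DistribMulAction H E] [IsIsometricSMul H E] [ContinuousSMul H E]
    (hE : ∀ U ∈ 𝓝 (1 : H), ∃ f : E, ∀ x ∉ U, 1 ≤ ‖x • f - f‖) :
    ∃ (K : HausdorffTopGroup.{u}) (j : H →* K) (t : K), t ≠ 1 ∧
      ∀ (L : HausdorffTopGroup.{u}) (f : K →* L), Continuous f → f t ≠ 1 →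
        IsEmbedding (f.comp j) := by
  let G := AddSemidirect E H
  obtain ⟨t, ht, h⟩ := exists_conj_small_of_isometric (AddSemidirect.inr : H →* G) (0 : E) (by
    intro U hU R
    obtain ⟨f, hf⟩ := hE U hU
    obtain ⟨n, hn⟩ := exists_nat_ge R
    -- Translation by `n • f` carries `0` to a point that `x` displaces by `n * ‖x • f - f‖ ≥ n ≥
    -- R`.
    refine ⟨⟨n • f, 1⟩, fun x hx => ?_⟩
    have h1 := hf x hx
    simp only [AddSemidirect.smul_def, AddSemidirect.inr_left, AddSemidirect.inr_right, smul_zero,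
      add_zero, zero_add, dist_eq_norm]
    rw [smul_comm x n f, ← smul_sub, ← Nat.cast_smul_eq_nsmul ℝ, norm_smul, Real.norm_natCast]
    nlinarith [(Nat.cast_nonneg n : (0 : ℝ) ≤ n)])
  refine ⟨⟨AddSemidirect (ContTranslates G E) G⟩, AddSemidirect.inr.comp AddSemidirect.inr, t, ht,
    fun L f hf hft => ?_⟩
  exact isEmbedding_comp_of_conj_small (K := AddSemidirect (ContTranslates G E) G)
    (AddSemidirect.inr.comp (AddSemidirect.inr : H →* G))
    (AddSemidirect.isEmbedding_inr.continuous.comp AddSemidirect.isEmbedding_inr.continuous)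
    t h f hf hft

theorem mainTheorem2 (𝒢 : Set HausdorffTopGroup.{u})
    (hsub : HausdorffTopGroup.ClosedUnderSubgroups 𝒢)
    (hprod : ∀ G : HausdorffTopGroup.{u}, ∃ (ι : Type u) (K : ι → HausdorffTopGroup.{u}),
      (∀ i, K i ∈ 𝒢) ∧ G.IsIsoToSubgroupOf (HausdorffTopGroup.prod K)) :
    𝒢 = Set.univ := by
  refine Set.eq_univ_of_forall fun H => ?_
  obtain ⟨K, j, t, ht, h⟩ := exists_rigid_overgroup_of_normedSpace (H := H) (E := BddUnifCont H)
    fun U hU => exists_norm_smul_sub_ge hU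
  obtain ⟨ι, L, hL, S, ⟨e⟩⟩ := hprod K
  let p : K →* HausdorffTopGroup.prod L := S.subtype.comp e.toMulEquiv.toMonoidHom
  have hp : Continuous p := continuous_subtype_val.comp e.continuous
  have hpt : p t ≠ 1 := fun h1 => ht (e.injective (Subtype.ext (by
    rw [map_one]; exact h1)))
  obtain ⟨i, hi⟩ := Function.ne_iff.1 hpt
  let π : HausdorffTopGroup.prod L →* L i := Pi.evalMonoidHom (fun i => L i) i
  have hπ : Continuous π := continuous_apply (A := fun i => L i) i
  have hemb := h (L i) (π.comp p) (hπ.comp hp) hi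
  exact hsub H (L i) (hL i) ⟨((π.comp p).comp j).range,
    ⟨{ MonoidHom.ofInjective hemb.injective with
       continuous_toFun := hemb.toHomeomorph.continuous
       continuous_invFun := by
        refine hemb.continuous_iff.2 (continuous_subtype_val.congr fun y => ?_)
        exact congrArg Subtype.val
          ((MonoidHom.ofInjective hemb.injective).apply_symm_apply y).symm }⟩⟩
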